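/- Let $\mathcal H$ be a complex Hilbert space with an orthonormal basis $\{e_i\}_{i=0}^\infty$, let $\alpha=\{\alpha_i\}_{i=0}^\infty$ be a convergent sequence of complex numbers, and let $S_\alpha$ be the weighted shift on $\mathcal H$ with weight $\alpha$, i.e. the bounded operator with $S_\alpha e_i=\alpha_i e_{i+1}$ for $i\ge 0$. For $A_1,\dots,A_n\in\mathcal B(\mathcal H)$ put $$\mathrm S_n(A_1,\dots,A_n)=\frac1{n!}\sum_{\pi\in\Sigma_n}A_{\pi(1)}\otimes\cdots\otimes A_{\pi(n)}\in\mathcal B(\mathcal H^{\otimes n}),$$ where $\mathcal H^{\otimes n}$ is the Hilbert space tensor power and $\Sigma_n$ is the group of permutations of $\{1,\dots,n\}$. This operator leaves invariant the symmetric tensor space $\mathcal H^{\odot n}$ and the antisymmetric tensor space $\mathcal H^{\wedge n}$, that is, the closed linear spans in $\mathcal H^{\otimes n}$ of the vectors $\frac1{n!}\sum_\pi v_{\pi(1)}\otimes\cdots\otimes v_{\pi(n)}$ and $\frac1{n!}\sum_\pi \operatorname{sgn}(\pi)\,v_{\pi(1)}\otimes\cdots\otimes v_{\pi(n)}$ respectively.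 Let $$A_1\odot\cdots\odot A_n=\mathrm S_n(A_1,\dots,A_n)|_{\mathcal H^{\odot n}},\qquad A_1\wedge\cdots\wedge A_n=\mathrm S_n(A_1,\dots,A_n)|_{\mathcal H^{\wedge n}}.$$ Then the following statements are equivalent (here $\mathbb N=\{0,1,2,\dots\}$): (1) $\alpha$ is regular, i.e. $\lim_{i\to\infty}|\alpha_i|\ge|\alpha_m|$ for every $m\in\mathbb N$; (2) for every $n\ge2$, every $0\le k\le n$ and every $(l_1,\dots,l_n)\in\mathbb N^n$, $$\|S_\alpha^{l_1}\odot\cdots\odot S_\alpha^{l_k}\odot S_\alpha^{*l_{k+1}}\odot\cdots\odot S_\alpha^{*l_n}\|=\prod_{i=1}^n\|S_\alpha^{l_i}\|;$$ (3) for every $n\ge2$, every $0\le k\le n$ and every $(l_1,\dots,l_n)\in\mathbb N^n$, $$\|S_\alpha^{l_1}\wedge\cdots\wedge S_\alpha^{l_k}\wedge S_\alpha^{*l_{k+1}}\wedge\cdots\wedge S_\alpha^{*l_n}\|=\prod_{i=1}^n\|S_\alpha^{l_i}\|.$$ In this case, with $\lambda=\lim_{i\to\infty}|\alpha_i|$,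 for all such $n$, $k$ and $(l_1,\dots,l_n)$, $$\|S_\alpha^{l_1}\odot\cdots\odot S_\alpha^{l_k}\odot S_\alpha^{*l_{k+1}}\odot\cdots\odot S_\alpha^{*l_n}\|=\|S_\alpha^{l_1}\wedge\cdots\wedge S_\alpha^{l_k}\wedge S_\alpha^{*l_{k+1}}\wedge\cdots\wedge S_\alpha^{*l_n}\|=\lambda^{l_1+\cdots+l_n}$$ (with the convention $0^0=1$). -/

import Mathlib

open Filter Topology UniformSpace
open scoped TensorProduct InnerProductSpace ComplexOrder

noncomputable section

namespace TensorShift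

variable {H : Type*} [NormedAddCommGroup H] [InnerProductSpace ℂ H]

/-! ### Products of positive semidefinite kernels -/

theorem posSemidef_gram {J : Type*} (v : J → H) : (Matrix.gram ℂ v).PosSemidef := by
  refine ⟨Matrix.isHermitian_gram ℂ v, fun c => ?_⟩
  have h : (c.sum fun i a => c.sum fun j b => star a * Matrix.gram ℂ v i j * b) =
      ⟪c.sum fun i a => a • v i, c.sum fun i a => a • v i⟫_ℂ := by
    simp only [Finsupp.sum, sum_inner, inner_sum, inner_smul_left, inner_smul_right,
      Matrix.gram_apply, starRingEnd_apply, Finset.mul_sum]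
    rw [Finset.sum_comm]
    refine Finset.sum_congr rfl fun i _ => Finset.sum_congr rfl fun j _ => ?_
    ring
  rw [h, inner_self_eq_norm_sq_to_K]
  positivity

theorem posSemidef_prod {J ι : Type*} (s : Finset ι) (P : ι → Matrix J J ℂ)
    (hP : ∀ i, (P i).PosSemidef) :
    (Matrix.of fun a b => ∏ i ∈ s, P i a b).PosSemidef := by
  classical
  induction s using Finset.induction_on with
  | empty =>
    have h := posSemidef_gram (fun _ : J => (1 : ℂ))
    have e : (Matrix.of fun a b => ∏ i ∈ (∅ : Finset ι), P i a b) =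
        Matrix.gram ℂ (fun _ : J => (1 : ℂ)) := by
      ext a b
      simp [Matrix.gram]
    rw [e]
    exact h
  | insert i s hi ih =>
    have e : (Matrix.of fun a b => ∏ i ∈ insert i s, P i a b) =
        (P i).hadamard (Matrix.of fun a b => ∏ i ∈ s, P i a b) := by
      ext a b
      simp [Finset.prod_insert hi, Matrix.hadamard]
    rw [e]
    exact (hP i).hadamard ih

theorem posSemidef_prod_sub {J ι : Type*} (s : Finset ι) (U V : ι → Matrix J J ℂ)
    (hU : ∀ i, (U i).PosSemidef) (hV : ∀ i, (V i).PosSemidef)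
    (hUV : ∀ i, (U i - V i).PosSemidef) :
    (Matrix.of fun a b => ∏ i ∈ s, U i a b - ∏ i ∈ s, V i a b).PosSemidef := by
  classical
  induction s using Finset.induction_on with
  | empty =>
    have e : (Matrix.of fun a b => ∏ i ∈ (∅ : Finset ι), U i a b -
        ∏ i ∈ (∅ : Finset ι), V i a b) = (0 : Matrix J J ℂ) := by
      ext a b
      simp
    rw [e]
    exact Matrix.PosSemidef.zero
  | insert i s hi ih =>
    have e : (Matrix.of fun a b => ∏ i ∈ insert i s, U i a b - ∏ i ∈ insert i s, V i a b) =
        (U i).hadamard (Matrix.of fun a b => ∏ i ∈ s, U i a b - ∏ i ∈ s, V i a b) +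
          (U i - V i).hadamard (Matrix.of fun a b => ∏ i ∈ s, V i a b) := by
      ext a b
      simp only [Finset.prod_insert hi, Matrix.hadamard, Matrix.of_apply, Matrix.add_apply,
        Matrix.sub_apply]
      ring
    rw [e]
    exact ((hU i).hadamard ih).add ((hUV i).hadamard (posSemidef_prod s V hV))

/-! ### The algebraic tensor power with its canonical inner product -/

variable (H) in
/-- The algebraic `n`-fold tensor power of `H` over `ℂ`. (A copy of Mathlib's `⨂[ℂ] _ : Fin n, H`
that does not carry the projective norm.) -/
def AlgTensorPower (n : ℕ) : Type _ := ⨂[ℂ] _ : Fin n, H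

variable {n : ℕ}

instance : AddCommGroup (AlgTensorPower H n) :=
  inferInstanceAs (AddCommGroup (⨂[ℂ] _ : Fin n, H))

instance : Module ℂ (AlgTensorPower H n) :=
  inferInstanceAs (Module ℂ (⨂[ℂ] _ : Fin n, H))

namespace AlgTensorPower

/-- The pure tensor `v₁ ⊗ ⋯ ⊗ vₙ`, as a multilinear function of `v`. -/
def tprod : MultilinearMap ℂ (fun _ : Fin n => H) (AlgTensorPower H n) :=
  PiTensorProduct.tprod ℂ

/-- The linear functional with `v₁ ⊗ ⋯ ⊗ vₙ ↦ ∏ ⟪wᵢ, vᵢ⟫`. -/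
def pairing (w : Fin n → H) : AlgTensorPower H n →ₗ[ℂ] ℂ :=
  PiTensorProduct.lift
    ((MultilinearMap.mkPiAlgebra ℂ (Fin n) ℂ).compLinearMap fun i => innerₛₗ ℂ (w i))

theorem pairing_tprod (w v : Fin n → H) : pairing w (tprod v) = ∏ i, ⟪w i, v i⟫_ℂ := by
  unfold pairing tprod
  erw [PiTensorProduct.lift.tprod]
  simp

theorem span_tprod : Submodule.span ℂ (Set.range (tprod (H := H) (n := n))) = ⊤ :=
  PiTensorProduct.span_tprod_eq_top

theorem exists_finsupp (x : AlgTensorPower H n) :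
    ∃ c : (Fin n → H) →₀ ℂ, (c.sum fun v a => a • tprod v) = x := by
  have hx : x ∈ Submodule.span ℂ (Set.range (tprod (H := H) (n := n))) := by
    rw [span_tprod]; trivial
  exact Finsupp.mem_span_range_iff_exists_finsupp.1 hx

theorem induction_tprod {p : AlgTensorPower H n → Prop} (x : AlgTensorPower H n)
    (ht : ∀ (r : ℂ) (v : Fin n → H), p (r • tprod v)) (ha : ∀ x y, p x → p y → p (x + y)) : p x :=
  PiTensorProduct.induction_on x ht (fun x y => ha x y)

theorem pairing_add [DecidableEq (Fin n)] (w : Fin n → H) (i : Fin n) (a b : H)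
    (x : AlgTensorPower H n) :
    pairing (Function.update w i (a + b)) x =
      pairing (Function.update w i a) x + pairing (Function.update w i b) x := by
  induction x using induction_tprod with
  | ht r v =>
    simp only [map_smul, pairing_tprod, smul_eq_mul, ← mul_add]
    congr 1
    rw [← Finset.mul_prod_erase _ _ (Finset.mem_univ i),
      ← Finset.mul_prod_erase _ _ (Finset.mem_univ i),
      ← Finset.mul_prod_erase Finset.univ (fun j => ⟪Function.update w i b j, v j⟫_ℂ)
        (Finset.mem_univ i)]
    have h (c : H) : ∏ x ∈ Finset.univ.erase i, ⟪Function.update w i c x, v x⟫_ℂ =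
        ∏ x ∈ Finset.univ.erase i, ⟪w x, v x⟫_ℂ :=
      Finset.prod_congr rfl fun j hj => by
        rw [Function.update_of_ne (Finset.ne_of_mem_erase hj)]
    simp only [h, Function.update_self, inner_add_left]
    ring
  | ha x y hx hy =>
    simp only [map_add, hx, hy]
    ring

theorem pairing_smul [DecidableEq (Fin n)] (w : Fin n → H) (i : Fin n) (c : ℂ) (a : H)
    (x : AlgTensorPower H n) :
    pairing (Function.update w i (c • a)) x =
      starRingEnd ℂ c * pairing (Function.update w i a) x := by
  induction x using induction_tprod with
  | ht r v =>
    simp only [map_smul, pairing_tprod, smul_eq_mul]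
    rw [mul_left_comm]
    congr 1
    rw [← Finset.mul_prod_erase _ _ (Finset.mem_univ i),
      ← Finset.mul_prod_erase Finset.univ (fun j => ⟪Function.update w i a j, v j⟫_ℂ)
        (Finset.mem_univ i)]
    have h (c : H) : ∏ x ∈ Finset.univ.erase i, ⟪Function.update w i c x, v x⟫_ℂ =
        ∏ x ∈ Finset.univ.erase i, ⟪w x, v x⟫_ℂ :=
      Finset.prod_congr rfl fun j hj => by
        rw [Function.update_of_ne (Finset.ne_of_mem_erase hj)]
    simp only [h, Function.update_self, inner_smul_left]
    ring
  | ha x y hx hy =>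
    simp only [map_add, hx, hy]
    ring

/-- The sesquilinear form with `(⊗ wᵢ, ⊗ vᵢ) ↦ ∏ ⟪vᵢ, wᵢ⟫`: linear in the first argument and
conjugate linear in the second one. -/
def form : AlgTensorPower H n →ₗ[ℂ] (AlgTensorPower H n →ₗ⋆[ℂ] ℂ) :=
  PiTensorProduct.lift
    { toFun := fun w => (starLinearEquiv ℂ (A := ℂ)).toLinearMap.comp (pairing w)
      map_update_add' := fun w i a b => by
        ext x
        simp [pairing_add]
      map_update_smul' := fun w i c a => by
        ext x
        simp [pairing_smul] }

theorem form_tprod (w : Fin n → H) (x : AlgTensorPower H n) :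
    form (tprod w) x = starRingEnd ℂ (pairing w x) := by
  have h : form (tprod w) = (starLinearEquiv ℂ (A := ℂ)).toLinearMap.comp (pairing w) := by
    unfold form tprod
    exact PiTensorProduct.lift.tprod (R := ℂ) (s := fun _ : Fin n => H) w
  rw [h]
  simp

theorem form_tprod_tprod (w v : Fin n → H) :
    form (tprod w) (tprod v) = ∏ i, ⟪v i, w i⟫_ℂ := by
  simp [form_tprod, pairing_tprod, map_prod]

theorem form_sum {J K : Type*} (p : J → Fin n → H) (q : K → Fin n → H) (c : J →₀ ℂ) (d : K →₀ ℂ) :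
    form (c.sum fun v a => a • tprod (p v)) (d.sum fun v a => a • tprod (q v)) =
      d.sum fun v a => c.sum fun w b => star a * (∏ i, ⟪q v i, p w i⟫_ℂ) * b := by
  simp only [Finsupp.sum, map_sum, LinearMap.sum_apply, map_smul, LinearMap.smul_apply,
    LinearMap.map_smulₛₗ, form_tprod_tprod, smul_eq_mul, Finset.mul_sum]
  refine Finset.sum_congr rfl fun v _ => Finset.sum_congr rfl fun w _ => ?_
  simp only [starRingEnd_apply]
  ring

theorem form_symm (x y : AlgTensorPower H n) : starRingEnd ℂ (form x y) = form y x := by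
  obtain ⟨c, rfl⟩ := exists_finsupp x
  obtain ⟨d, rfl⟩ := exists_finsupp y
  rw [form_sum (fun v => v) (fun v => v) c d, form_sum (fun v => v) (fun v => v) d c]
  simp only [Finsupp.sum, map_sum, map_mul, map_prod, inner_conj_symm]
  conv_lhs => rw [Finset.sum_comm]
  refine Finset.sum_congr rfl fun v _ => Finset.sum_congr rfl fun w _ => ?_
  simp only [starRingEnd_apply, star_star]
  ring

theorem form_self_nonneg (x : AlgTensorPower H n) : 0 ≤ form x x := by
  obtain ⟨c, rfl⟩ := exists_finsupp x
  rw [form_sum (fun v => v) (fun v => v) c c]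
  exact (posSemidef_prod (J := Fin n → H) Finset.univ
    (fun i => Matrix.gram ℂ fun v : Fin n → H => v i) fun i => posSemidef_gram _).2 c

instance : PreInnerProductSpace.Core ℂ (AlgTensorPower H n) where
  inner x y := form y x
  conj_inner_symm _ _ := form_symm _ _
  re_inner_nonneg x := (Complex.le_def.1 (form_self_nonneg x)).1
  add_left _ _ _ := map_add _ _ _
  smul_left _ _ _ := LinearMap.map_smulₛₗ _ _ _

instance : SeminormedAddCommGroup (AlgTensorPower H n) :=
  InnerProductSpace.Core.toSeminormedAddCommGroup (𝕜 := ℂ)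

instance : InnerProductSpace ℂ (AlgTensorPower H n) := .ofCore _

theorem inner_eq_form (x y : AlgTensorPower H n) : ⟪x, y⟫_ℂ = form y x := rfl

theorem inner_tprod (v w : Fin n → H) : ⟪tprod v, tprod w⟫_ℂ = ∏ i, ⟪v i, w i⟫_ℂ := by
  rw [inner_eq_form, form_tprod_tprod]

/-- The algebraic tensor product `A₁ ⊗ ⋯ ⊗ Aₙ`. -/
def mapₗ (A : Fin n → H →L[ℂ] H) : AlgTensorPower H n →ₗ[ℂ] AlgTensorPower H n :=
  PiTensorProduct.map fun i => (A i : H →ₗ[ℂ] H)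

theorem mapₗ_tprod (A : Fin n → H →L[ℂ] H) (v : Fin n → H) :
    mapₗ A (tprod v) = tprod fun i => A i (v i) :=
  PiTensorProduct.map_tprod _ _

theorem norm_mapₗ_le (A : Fin n → H →L[ℂ] H) (x : AlgTensorPower H n) :
    ‖mapₗ A x‖ ≤ (∏ i, ‖A i‖) * ‖x‖ := by
  have key : 0 ≤ ((∏ i, ‖A i‖ : ℝ) : ℂ) ^ 2 * ⟪x, x⟫_ℂ - ⟪mapₗ A x, mapₗ A x⟫_ℂ := by
    obtain ⟨c, rfl⟩ := exists_finsupp x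
    have h := (posSemidef_prod_sub (J := Fin n → H) Finset.univ
      (fun i => ‖A i‖ ^ 2 • Matrix.gram ℂ fun v : Fin n → H => v i)
      (fun i => Matrix.gram ℂ (A i ∘ fun v : Fin n → H => v i))
      (fun i => (posSemidef_gram _).smul (by positivity))
      (fun i => posSemidef_gram _)
      (fun i => Matrix.posSemidef_opNorm_smul_gram_sub_gram _ (A i))).2 c
    refine h.trans_eq ?_
    have hA : mapₗ A (c.sum fun v a => a • tprod v) =
        c.sum fun v a => a • tprod fun i => A i (v i) := by
      simp only [Finsupp.sum, map_sum, map_smul, mapₗ_tprod]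
    rw [hA, inner_eq_form, inner_eq_form, form_sum (fun v => v) (fun v => v) c c,
      form_sum (fun (v : Fin n → H) i => A i (v i)) (fun (v : Fin n → H) i => A i (v i)) c c]
    simp only [Finsupp.sum, Finset.mul_sum]
    rw [← Finset.sum_sub_distrib]
    refine Finset.sum_congr rfl fun v _ => ?_
    rw [← Finset.sum_sub_distrib]
    refine Finset.sum_congr rfl fun w _ => ?_
    simp only [Matrix.of_apply, Matrix.smul_apply, Matrix.gram_apply, Complex.real_smul,
      Finset.prod_mul_distrib, Complex.ofReal_pow, Complex.ofReal_prod, Finset.prod_pow,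
      Function.comp_apply]
    ring
  rw [inner_self_eq_norm_sq_to_K, inner_self_eq_norm_sq_to_K] at key
  have key' : ‖mapₗ A x‖ ^ 2 ≤ ((∏ i, ‖A i‖) * ‖x‖) ^ 2 := by
    rw [mul_pow]
    rw [sub_nonneg] at key
    simp only [Complex.coe_algebraMap] at key
    exact_mod_cast key
  exact le_of_sq_le_sq key' (by positivity)

/-- The bounded operator `A₁ ⊗ ⋯ ⊗ Aₙ` on the algebraic tensor power. -/
def mapL (A : Fin n → H →L[ℂ] H) : AlgTensorPower H n →L[ℂ] AlgTensorPower H n :=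
  (mapₗ A).mkContinuous (∏ i, ‖A i‖) (norm_mapₗ_le A)

end AlgTensorPower

/-! ### The Hilbert space tensor power and its symmetric and antisymmetric parts -/

variable (H) in
/-- The full tensor space `H^{⊗ n}`: the completion of the algebraic tensor power for the inner
product with `⟪⊗ vᵢ, ⊗ wᵢ⟫ = ∏ ⟪vᵢ, wᵢ⟫`. -/
abbrev TensorPower (n : ℕ) : Type _ := Completion (AlgTensorPower H n)

/-- The pure tensor `v₁ ⊗ ⋯ ⊗ vₙ` in `H^{⊗ n}`. -/
def pureTensor (v : Fin n → H) : TensorPower H n := (AlgTensorPower.tprod v : AlgTensorPower H n)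

theorem inner_pureTensor (v w : Fin n → H) :
    ⟪pureTensor v, pureTensor w⟫_ℂ = ∏ i, ⟪v i, w i⟫_ℂ := by
  rw [pureTensor, pureTensor, Completion.inner_coe, AlgTensorPower.inner_tprod]

theorem span_pureTensor_dense :
    (Submodule.span ℂ (Set.range (pureTensor (H := H) (n := n)))).topologicalClosure = ⊤ := by
  rw [eq_top_iff]
  intro x _
  refine Completion.denseRange_coe.induction_on
    (p := fun x => x ∈ (Submodule.span ℂ
      (Set.range (pureTensor (H := H) (n := n)))).topologicalClosure) x
    (Submodule.isClosed_topologicalClosure _) fun y => ?_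
  refine Submodule.le_topologicalClosure _ ?_
  induction y using AlgTensorPower.induction_tprod with
  | ht r v =>
    rw [Completion.coe_smul]
    exact Submodule.smul_mem _ _ (Submodule.subset_span ⟨v, rfl⟩)
  | ha x y hx hy =>
    rw [Completion.coe_add]
    exact Submodule.add_mem _ hx hy

/-- The bounded operator `A₁ ⊗ ⋯ ⊗ Aₙ` on `H^{⊗ n}`. -/
def tensorOp (A : Fin n → H →L[ℂ] H) : TensorPower H n →L[ℂ] TensorPower H n :=
  (AlgTensorPower.mapL A).completion

theorem tensorOp_pureTensor (A : Fin n → H →L[ℂ] H) (v : Fin n → H) :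
    tensorOp A (pureTensor v) = pureTensor fun i => A i (v i) := by
  have h : AlgTensorPower.mapL A (AlgTensorPower.tprod v) =
      AlgTensorPower.tprod fun i => A i (v i) := AlgTensorPower.mapₗ_tprod A v
  simp only [tensorOp, pureTensor]
  rw [← h]
  exact Completion.map_coe (AlgTensorPower.mapL A).uniformContinuous _

/-- The symmetrized operator
`Sₙ(A₁, …, Aₙ) = (1 / n!) ∑_π A_{π(1)} ⊗ ⋯ ⊗ A_{π(n)}` on `H^{⊗ n}`. -/
def symmOp (A : Fin n → H →L[ℂ] H) : TensorPower H n →L[ℂ] TensorPower H n :=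
  ((n.factorial : ℂ)⁻¹) • ∑ π : Equiv.Perm (Fin n), tensorOp fun i => A (π i)

/-- The symmetric tensor `v₁ ⊙ ⋯ ⊙ vₙ = (1 / n!) ∑_π v_{π(1)} ⊗ ⋯ ⊗ v_{π(n)}`. -/
def symmTensor (v : Fin n → H) : TensorPower H n :=
  ((n.factorial : ℂ)⁻¹) • ∑ π : Equiv.Perm (Fin n), pureTensor fun i => v (π i)

/-- The antisymmetric tensor
`v₁ ∧ ⋯ ∧ vₙ = (1 / n!) ∑_π sgn(π) v_{π(1)} ⊗ ⋯ ⊗ v_{π(n)}`. -/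
def wedgeTensor (v : Fin n → H) : TensorPower H n :=
  ((n.factorial : ℂ)⁻¹) • ∑ π : Equiv.Perm (Fin n),
    ((Equiv.Perm.sign π : ℤ) : ℂ) • pureTensor fun i => v (π i)

variable (H) in
/-- The symmetric tensor space `H^{⊙ n}`: the closed linear span of the symmetric tensors. -/
def symmPower (n : ℕ) : Submodule ℂ (TensorPower H n) :=
  (Submodule.span ℂ (Set.range (symmTensor (H := H) (n := n)))).topologicalClosure

variable (H) in
/-- The antisymmetric tensor space `H^{∧ n}`: the closed linear span of the antisymmetric
tensors. -/
def wedgePower (n : ℕ) : Submodule ℂ (TensorPower H n) :=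
  (Submodule.span ℂ (Set.range (wedgeTensor (H := H) (n := n)))).topologicalClosure

theorem mapsTo_closure_span {E : Type*} [NormedAddCommGroup E] [NormedSpace ℂ E]
    (T : E →L[ℂ] E) (s : Set E)
    (h : ∀ x ∈ s, T x ∈ Submodule.span ℂ s) :
    ∀ x ∈ (Submodule.span ℂ s).topologicalClosure,
      T x ∈ (Submodule.span ℂ s).topologicalClosure := by
  have h0 : Submodule.span ℂ s ≤ (Submodule.span ℂ s).comap (T : E →ₗ[ℂ] E) :=
    Submodule.span_le.2 fun x hx => h x hx
  have h1 : ∀ x ∈ Submodule.span ℂ s, T x ∈ Submodule.span ℂ s := fun x hx => h0 hx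
  intro x hx
  exact map_mem_closure T.continuous hx h1

theorem symmOp_symmTensor (A : Fin n → H →L[ℂ] H) (v : Fin n → H) :
    symmOp A (symmTensor v) =
      ((n.factorial : ℂ)⁻¹) • ∑ π : Equiv.Perm (Fin n), symmTensor fun i => A (π i) (v i) := by
  simp only [symmOp, symmTensor, _root_.smul_apply, _root_.sum_apply,
    map_smul, map_sum, tensorOp_pureTensor, ← Finset.smul_sum]
  congr 2
  conv_rhs => rw [Finset.sum_comm]
  refine Finset.sum_congr rfl fun τ _ => ?_
  exact Fintype.sum_equiv (Equiv.mulRight τ⁻¹) _ _ fun π => by simp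

theorem symmOp_wedgeTensor (A : Fin n → H →L[ℂ] H) (v : Fin n → H) :
    symmOp A (wedgeTensor v) =
      ((n.factorial : ℂ)⁻¹) • ∑ π : Equiv.Perm (Fin n), wedgeTensor fun i => A (π i) (v i) := by
  simp only [symmOp, wedgeTensor, _root_.smul_apply, _root_.sum_apply, map_smul, map_sum,
    tensorOp_pureTensor, Finset.smul_sum]
  conv_rhs => rw [Finset.sum_comm]
  refine Finset.sum_congr rfl fun τ _ => ?_
  refine Fintype.sum_equiv (Equiv.mulRight τ⁻¹) _ _ fun π => ?_
  rw [smul_comm (((Equiv.Perm.sign τ : ℤ) : ℂ)) ((n.factorial : ℂ)⁻¹)]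
  simp

theorem symmOp_mem_symmPower (A : Fin n → H →L[ℂ] H) :
    ∀ x ∈ symmPower H n, symmOp A x ∈ symmPower H n := by
  refine mapsTo_closure_span (symmOp A) _ ?_
  rintro _ ⟨v, rfl⟩
  rw [symmOp_symmTensor]
  refine Submodule.smul_mem _ _ (Submodule.sum_mem _ fun π _ => ?_)
  exact Submodule.subset_span ⟨_, rfl⟩

theorem symmOp_mem_wedgePower (A : Fin n → H →L[ℂ] H) :
    ∀ x ∈ wedgePower H n, symmOp A x ∈ wedgePower H n := by
  refine mapsTo_closure_span (symmOp A) _ ?_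
  rintro _ ⟨v, rfl⟩
  rw [symmOp_wedgeTensor]
  refine Submodule.smul_mem _ _ (Submodule.sum_mem _ fun π _ => ?_)
  exact Submodule.subset_span ⟨_, rfl⟩

/-- The symmetric tensor product `A₁ ⊙ ⋯ ⊙ Aₙ`, an operator on `H^{⊙ n}`. -/
def symmProd (A : Fin n → H →L[ℂ] H) : symmPower H n →L[ℂ] symmPower H n :=
  (symmOp A).restrict (symmOp_mem_symmPower A)

/-- The antisymmetric tensor product `A₁ ∧ ⋯ ∧ Aₙ`, an operator on `H^{∧ n}`. -/
def wedgeProd (A : Fin n → H →L[ℂ] H) : wedgePower H n →L[ℂ] wedgePower H n :=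
  (symmOp A).restrict (symmOp_mem_wedgePower A)

/-! ### Weighted shifts -/

/-- `S` is the weighted shift with weight `α` with respect to the orthonormal basis `e`:
`S eᵢ = αᵢ eᵢ₊₁`. A bounded operator is determined by these equations. -/
def IsWeightedShift (e : HilbertBasis ℕ ℂ H) (α : ℕ → ℂ) (S : H →L[ℂ] H) : Prop :=
  ∀ i, S (e i) = α i • e (i + 1)

theorem norm_sq_finsupp_sum {v : ℕ → H} (hv : Orthonormal ℂ v) (c : ℕ →₀ ℂ) (d : ℕ → ℂ) :
    ‖∑ i ∈ c.support, d i • v i‖ ^ 2 = ∑ i ∈ c.support, ‖d i‖ ^ 2 := by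
  have h := hv.inner_sum d d c.support
  rw [inner_self_eq_norm_sq_to_K] at h
  simp only [Complex.conj_mul', Complex.coe_algebraMap] at h
  exact_mod_cast h

/-- Every convergent weight has exactly one (bounded) weighted shift. -/
theorem existsUnique_isWeightedShift [CompleteSpace H] (e : HilbertBasis ℕ ℂ H) (α : ℕ → ℂ)
    (hα : ∃ a : ℂ, Tendsto α atTop (𝓝 a)) : ∃! S : H →L[ℂ] H, IsWeightedShift e α S := by
  obtain ⟨a, ha⟩ := hα
  obtain ⟨C, hC⟩ := ha.norm.bddAbove_range
  have hC' : ∀ i, ‖α i‖ ≤ C := fun i => hC ⟨i, rfl⟩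
  have hC0 : 0 ≤ C := (norm_nonneg _).trans (hC' 0)
  have he : Submodule.topologicalClosure (Submodule.span ℂ (Set.range e)) = ⊤ := e.dense_span
  let f : (ℕ →₀ ℂ) →ₗ[ℂ] H := Finsupp.linearCombination ℂ fun i => α i • e (i + 1)
  let g : (ℕ →₀ ℂ) →ₗ[ℂ] H := Finsupp.linearCombination ℂ e
  have hg : DenseRange g := by
    rw [DenseRange, ← LinearMap.coe_range, Finsupp.range_linearCombination]
    exact Submodule.dense_iff_topologicalClosure_eq_top.2 he
  have hn : ∃ C, ∀ x, ‖f x‖ ≤ C * ‖g x‖ := by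
    refine ⟨C, fun c => le_of_sq_le_sq ?_ (by positivity)⟩
    have h1 : f c = ∑ i ∈ c.support, (c i * α i) • e (i + 1) := by
      simp [f, Finsupp.linearCombination_apply, Finsupp.sum, smul_smul]
    have h2 : g c = ∑ i ∈ c.support, c i • e i := by
      simp [g, Finsupp.linearCombination_apply, Finsupp.sum]
    rw [mul_pow, h1, h2, norm_sq_finsupp_sum e.orthonormal c c,
      norm_sq_finsupp_sum (v := fun i => e (i + 1))
        (e.orthonormal.comp _ (add_left_injective 1)) c (fun i => c i * α i), Finset.mul_sum]
    refine Finset.sum_le_sum fun i _ => ?_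
    rw [norm_mul, mul_pow, mul_comm]
    gcongr
    exact hC' i
  refine ⟨f.extendOfNorm g, fun i => ?_, fun T hT => ?_⟩
  · have h := LinearMap.extendOfNorm_eq hg hn (Finsupp.single i 1)
    simpa [f, g] using h
  · refine ContinuousLinearMap.ext_on (Submodule.dense_iff_topologicalClosure_eq_top.2 he) ?_
    rintro _ ⟨i, rfl⟩
    have h := LinearMap.extendOfNorm_eq hg hn (Finsupp.single i 1)
    rw [hT i]
    simpa [f, g] using h.symm

/-- The regularity condition: `lim |αᵢ| ≥ |αₘ|` for every `m`. -/
def IsRegularWeight (α : ℕ → ℂ) : Prop :=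
  ∃ L : ℝ, Tendsto (fun i => ‖α i‖) atTop (𝓝 L) ∧ ∀ m, ‖α m‖ ≤ L

/-- The factors `S^{l₁}, …, S^{l_k}, S^{* l_{k+1}}, …, S^{* lₙ}` (numbered from `0` here). -/
def shiftFactors [CompleteSpace H] (S : H →L[ℂ] H) (k : ℕ) (l : Fin n → ℕ) :
    Fin n → H →L[ℂ] H :=
  fun i => if (i : ℕ) < k then S ^ l i else (ContinuousLinearMap.adjoint S) ^ l i

end TensorShift

end

/-! Write `a` for the limit of the weights.

*Lower bound.* Normalized indicators of long intervals of basis vectors far out satisfy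
`S v ≈ a v`, and over disjoint intervals they are orthonormal (`blockVector`). The matrix
coefficients between such vectors of every factor `S ^ l` or `S* ^ l` are therefore asymptotically
scalar, so `v₁ ⊙ ⋯ ⊙ vₙ` and `v₁ ∧ ⋯ ∧ vₙ`, both of squared norm `1 / n!`, give numerical values of
`Sₙ(A₁, …, Aₙ)` tending to a number of modulus `|a| ^ ∑ lᵢ` times `1 / n!`
(`prod_norm_le_norm_restrict_symmOp`). This needs no regularity.

*Upper bound.* Both norms are at most `∏ ‖S ^ lᵢ‖`, which under regularity is at most
`|a| ^ ∑ lᵢ`, since then `‖S‖ = sup |αᵢ| ≤ |a|`. So all of these numbers coincide.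

*Converse.* If some `|αₘ|` exceeds `|a|`, the case `n = 2`, `(l₁, l₂) = (1, 0)` fails already on
the full tensor square: `‖S ⊗ 1 + 1 ⊗ S‖ < 2 ‖S‖` (`IsWeightedShift.norm_symmOp_pair_lt`). Along
unit vectors `x` with `‖(S ⊗ 1 + 1 ⊗ S) x‖ → 2 ‖S‖`, both summands have norm tending to `‖S‖` and
their difference tends to `0`. As `S ⊗ 1` raises the degree in the first factor and `1 ⊗ S`
preserves it, induction on this degree shows that `x` has asymptotically no component of bounded
degree. But on high degrees `S ⊗ 1` has norm close to `|a| < ‖S‖`, a contradiction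
(`norm_add_lt_of_filtration`). -/

noncomputable section

namespace TensorShift

variable {H : Type*} [NormedAddCommGroup H] [InnerProductSpace ℂ H] {n : ℕ}

/-! ### Algebra and norms of tensor products of operators -/

theorem dense_span_pureTensor :
    Dense (Submodule.span ℂ (Set.range (pureTensor (H := H) (n := n))) :
      Set (TensorPower H n)) :=
  Submodule.dense_iff_topologicalClosure_eq_top.2 span_pureTensor_dense

theorem norm_tensorOp_le (A : Fin n → H →L[ℂ] H) : ‖tensorOp A‖ ≤ ∏ i, ‖A i‖ := by
  refine ContinuousLinearMap.opNorm_le_bound _ (Finset.prod_nonneg fun i _ => norm_nonneg _) ?_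
  intro x
  induction x using Completion.induction_on with
  | hp => exact isClosed_le (by fun_prop) (by fun_prop)
  | ih y =>
    have h : tensorOp A (y : TensorPower H n) = (AlgTensorPower.mapₗ A y : AlgTensorPower H n) :=
      Completion.map_coe (AlgTensorPower.mapL A).uniformContinuous y
    rw [h, Completion.norm_coe, Completion.norm_coe]
    exact AlgTensorPower.norm_mapₗ_le A y

theorem tensorOp_mul (A B : Fin n → H →L[ℂ] H) :
    tensorOp A * tensorOp B = tensorOp fun i => A i * B i := by
  refine ContinuousLinearMap.ext_on dense_span_pureTensor ?_
  rintro _ ⟨v, rfl⟩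
  simp [tensorOp_pureTensor]

theorem pureTensor_update_add (v : Fin n → H) (i : Fin n) (a b : H) :
    pureTensor (Function.update v i (a + b)) =
      pureTensor (Function.update v i a) + pureTensor (Function.update v i b) := by
  simp only [pureTensor, MultilinearMap.map_update_add, Completion.coe_add]

theorem tensorOp_update_add (A : Fin n → H →L[ℂ] H) (i : Fin n) (B C : H →L[ℂ] H) :
    tensorOp (Function.update A i (B + C)) =
      tensorOp (Function.update A i B) + tensorOp (Function.update A i C) := by
  refine ContinuousLinearMap.ext_on dense_span_pureTensor ?_
  rintro _ ⟨v, rfl⟩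
  have h (D : H →L[ℂ] H) : (fun j => Function.update A i D j (v j)) =
      Function.update (fun j => A j (v j)) i (D (v i)) := by
    funext j
    obtain rfl | hj := eq_or_ne j i
    · simp
    · simp [hj]
  simp only [tensorOp_pureTensor, _root_.add_apply, h, pureTensor_update_add]

theorem adjoint_tensorOp [CompleteSpace H] (A : Fin n → H →L[ℂ] H) :
    ContinuousLinearMap.adjoint (tensorOp A) =
      tensorOp fun i => ContinuousLinearMap.adjoint (A i) := by
  refine ContinuousLinearMap.ext_on dense_span_pureTensor ?_
  rintro _ ⟨v, rfl⟩
  have h : innerSL ℂ (ContinuousLinearMap.adjoint (tensorOp A) (pureTensor v)) =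
      innerSL ℂ (tensorOp (fun i => ContinuousLinearMap.adjoint (A i)) (pureTensor v)) := by
    refine ContinuousLinearMap.ext_on dense_span_pureTensor ?_
    rintro _ ⟨w, rfl⟩
    simp [ContinuousLinearMap.adjoint_inner_left, tensorOp_pureTensor, inner_pureTensor]
  exact ext_inner_right ℂ fun y => DFunLike.congr_fun h y

theorem norm_symmOp_le (A : Fin n → H →L[ℂ] H) : ‖symmOp A‖ ≤ ∏ i, ‖A i‖ := by
  have h : ‖∑ π : Equiv.Perm (Fin n), tensorOp fun i => A (π i)‖ ≤
      (n.factorial : ℝ) * ∏ i, ‖A i‖ := by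
    refine (norm_sum_le _ _).trans ?_
    refine (Finset.sum_le_card_nsmul _ _ (∏ i, ‖A i‖) fun π _ => ?_).trans_eq ?_
    · exact (norm_tensorOp_le _).trans_eq (Equiv.prod_comp π fun i => ‖A i‖)
    · rw [Finset.card_univ, Fintype.card_perm, Fintype.card_fin, nsmul_eq_mul]
  have hn : (0 : ℝ) < n.factorial := by exact_mod_cast n.factorial_pos
  rw [symmOp, norm_smul, norm_inv, Complex.norm_natCast, inv_mul_le_iff₀ hn]
  exact h

theorem norm_restrict_le {E : Type*} [NormedAddCommGroup E] [NormedSpace ℂ E] (T : E →L[ℂ] E)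
    {p : Submodule ℂ E} (h : ∀ x ∈ p, T x ∈ p) : ‖T.restrict h‖ ≤ ‖T‖ :=
  ContinuousLinearMap.opNorm_le_bound _ (norm_nonneg _) fun x => T.le_opNorm x

/-! ### Lower bounds from joint approximate eigenvectors -/

/-- If `⟪w k, T (w k)⟫ → d ‖w k‖²` along vectors `w k ∈ p` of constant nonzero norm, then `|d|` is
at most the norm of `T` restricted to `p`. -/
theorem norm_le_norm_restrict_of_tendsto {E : Type*} [NormedAddCommGroup E]
    [InnerProductSpace ℂ E] (T : E →L[ℂ] E) {p : Submodule ℂ E} (h : ∀ x ∈ p, T x ∈ p)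
    {w : ℕ → E} (hw : ∀ k, w k ∈ p) {c d : ℂ} (hc : c ≠ 0) (hn : ∀ᶠ k in atTop, ⟪w k, w k⟫_ℂ = c)
    (ht : Tendsto (fun k => ⟪w k, T (w k)⟫_ℂ) atTop (𝓝 (d * c))) : ‖d‖ ≤ ‖T.restrict h‖ := by
  have h1 : ‖d * c‖ ≤ ‖T.restrict h‖ * ‖c‖ := by
    refine le_of_tendsto ht.norm ?_
    filter_upwards [hn] with k hk
    have h2 : ‖T (w k)‖ ≤ ‖T.restrict h‖ * ‖w k‖ := (T.restrict h).le_opNorm ⟨w k, hw k⟩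
    have h3 : ‖c‖ = ‖w k‖ * ‖w k‖ := by
      rw [← hk, inner_self_eq_norm_sq_to_K]
      simp [sq]
    calc ‖⟪w k, T (w k)⟫_ℂ‖ ≤ ‖w k‖ * ‖T (w k)‖ := norm_inner_le_norm _ _
      _ ≤ ‖w k‖ * (‖T.restrict h‖ * ‖w k‖) := by gcongr
      _ = ‖T.restrict h‖ * ‖c‖ := by rw [h3]; ring
  rw [norm_mul] at h1
  exact le_of_mul_le_mul_right h1 (norm_pos_iff.2 hc)

/-- The tensor `(1 / n!) ∑_π χ(π) v_{π(1)} ⊗ ⋯ ⊗ v_{π(n)}`, which is `v₁ ⊙ ⋯ ⊙ vₙ` for `χ = 1` and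
`v₁ ∧ ⋯ ∧ vₙ` for `χ = sgn`. -/
def twistedTensor (χ : Equiv.Perm (Fin n) → ℂ) (v : Fin n → H) : TensorPower H n :=
  ((n.factorial : ℂ)⁻¹) • ∑ π : Equiv.Perm (Fin n), χ π • pureTensor fun i => v (π i)

theorem symmTensor_eq_twistedTensor (v : Fin n → H) : symmTensor v = twistedTensor 1 v := by
  simp [symmTensor, twistedTensor]

theorem wedgeTensor_eq_twistedTensor (v : Fin n → H) :
    wedgeTensor v = twistedTensor (fun π => ((Equiv.Perm.sign π : ℤ) : ℂ)) v := rfl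

theorem inner_twistedTensor (χ : Equiv.Perm (Fin n) → ℂ) (v w : Fin n → H) :
    ⟪twistedTensor χ v, twistedTensor χ w⟫_ℂ =
      (n.factorial : ℂ)⁻¹ * ((n.factorial : ℂ)⁻¹ *
        ∑ σ : Equiv.Perm (Fin n), ∑ τ : Equiv.Perm (Fin n),
          starRingEnd ℂ (χ σ) * (χ τ * ∏ i, ⟪v (σ i), w (τ i)⟫_ℂ)) := by
  simp only [twistedTensor, inner_smul_left, inner_smul_right, sum_inner, inner_sum,
    inner_pureTensor, Finset.mul_sum, map_inv₀, map_natCast]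
  rw [Finset.sum_comm]
  refine Finset.sum_congr rfl fun τ _ => Finset.sum_congr rfl fun σ _ => by ring

theorem sum_sum_perm_diagonal {χ : Equiv.Perm (Fin n) → ℂ} (hχ : ∀ π, ‖χ π‖ = 1) (d : Fin n → ℂ) :
    ∑ σ : Equiv.Perm (Fin n), ∑ τ : Equiv.Perm (Fin n),
      starRingEnd ℂ (χ σ) * (χ τ * ∏ i, if σ i = τ i then d (τ i) else 0) =
        n.factorial * ∏ i, d i := by
  have h (σ : Equiv.Perm (Fin n)) : ∑ τ : Equiv.Perm (Fin n),
      starRingEnd ℂ (χ σ) * (χ τ * ∏ i, if σ i = τ i then d (τ i) else 0) = ∏ i, d i := by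
    rw [Finset.sum_eq_single σ]
    · simp only [if_true]
      rw [Equiv.prod_comp σ d, ← mul_assoc, Complex.conj_mul', hχ]
      simp
    · intro τ _ hτ
      obtain ⟨i, hi⟩ : ∃ i, σ i ≠ τ i := by
        by_contra! hc
        exact hτ (Equiv.ext fun i => (hc i).symm)
      rw [Finset.prod_eq_zero (Finset.mem_univ i) (if_neg hi)]
      simp
    · simp
  simp [h, Fintype.card_perm]

theorem inner_twistedTensor_self {χ : Equiv.Perm (Fin n) → ℂ} (hχ : ∀ π, ‖χ π‖ = 1)
    {v : Fin n → H} (hv : Orthonormal ℂ v) :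
    ⟪twistedTensor χ v, twistedTensor χ v⟫_ℂ = (n.factorial : ℂ)⁻¹ := by
  have h := sum_sum_perm_diagonal hχ (fun _ => 1)
  have hn : (n.factorial : ℂ) ≠ 0 := by exact_mod_cast n.factorial_ne_zero
  simp only [inner_twistedTensor, orthonormal_iff_ite.1 hv, h]
  simp [hn]

/-- Along orthonormal systems that are asymptotically joint eigenvectors of the `A j` with
eigenvalues `c j`, in the weak sense of matrix coefficients, the numerical values of
`Sₙ(A₁, …, Aₙ)` at twisted tensors converge to `∏ c j` times the squared norm `1 / n!`. -/
theorem tendsto_inner_symmOp_twistedTensor {χ : Equiv.Perm (Fin n) → ℂ} (hχ : ∀ π, ‖χ π‖ = 1)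
    (A : Fin n → H →L[ℂ] H)
    (hA : ∀ v : Fin n → H, symmOp A (twistedTensor χ v) =
      ((n.factorial : ℂ)⁻¹) • ∑ π : Equiv.Perm (Fin n), twistedTensor χ fun i => A (π i) (v i))
    {v : ℕ → Fin n → H} {c : Fin n → ℂ}
    (hv : ∀ i j m, Tendsto (fun k => ⟪v k i, A m (v k j)⟫_ℂ) atTop
      (𝓝 (if i = j then c m else 0))) :
    Tendsto (fun k => ⟪twistedTensor χ (v k), symmOp A (twistedTensor χ (v k))⟫_ℂ) atTop
      (𝓝 ((∏ i, c i) * (n.factorial : ℂ)⁻¹)) := by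
  have hn : (n.factorial : ℂ) ≠ 0 := by exact_mod_cast n.factorial_ne_zero
  have h1 (π : Equiv.Perm (Fin n)) :
      Tendsto (fun k => ⟪twistedTensor χ (v k), twistedTensor χ fun i => A (π i) (v k i)⟫_ℂ) atTop
        (𝓝 ((∏ i, c i) * (n.factorial : ℂ)⁻¹)) := by
    have h2 := sum_sum_perm_diagonal hχ fun i => c (π i)
    rw [Equiv.prod_comp π c] at h2
    have e : (∏ i, c i) * (n.factorial : ℂ)⁻¹ = (n.factorial : ℂ)⁻¹ * ((n.factorial : ℂ)⁻¹ *
        (n.factorial * ∏ i, c i)) := by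
      field_simp
    rw [e, ← h2]
    simp only [inner_twistedTensor]
    refine Tendsto.const_mul _ (Tendsto.const_mul _ ?_)
    refine tendsto_finsetSum _ fun σ _ => tendsto_finsetSum _ fun τ _ => ?_
    refine Tendsto.const_mul _ (Tendsto.const_mul _ ?_)
    exact tendsto_finsetProd _ fun i _ => hv _ _ _
  have h3 := (tendsto_finsetSum Finset.univ fun π _ => h1 π).const_mul (n.factorial : ℂ)⁻¹
  simp only [hA, inner_smul_right, inner_sum]
  rwa [Finset.sum_const, Finset.card_univ, Fintype.card_perm, Fintype.card_fin, nsmul_eq_mul,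
    inv_mul_cancel_left₀ hn] at h3

/-- Joint approximate eigenvectors bound `Sₙ(A₁, …, Aₙ)` from below on any invariant subspace that
contains the twisted tensors. -/
theorem prod_norm_le_norm_restrict_symmOp {χ : Equiv.Perm (Fin n) → ℂ} (hχ : ∀ π, ‖χ π‖ = 1)
    (A : Fin n → H →L[ℂ] H)
    (hA : ∀ v : Fin n → H, symmOp A (twistedTensor χ v) =
      ((n.factorial : ℂ)⁻¹) • ∑ π : Equiv.Perm (Fin n), twistedTensor χ fun i => A (π i) (v i))
    {p : Submodule ℂ (TensorPower H n)} (hp : ∀ x ∈ p, symmOp A x ∈ p)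
    (hχp : ∀ v, twistedTensor χ v ∈ p)
    {v : ℕ → Fin n → H} (ho : ∀ᶠ k in atTop, Orthonormal ℂ (v k)) {c : Fin n → ℂ}
    (hv : ∀ i j m, Tendsto (fun k => ⟪v k i, A m (v k j)⟫_ℂ) atTop
      (𝓝 (if i = j then c m else 0))) :
    ∏ i, ‖c i‖ ≤ ‖(symmOp A).restrict hp‖ := by
  rw [← norm_prod]
  have hn : (n.factorial : ℂ)⁻¹ ≠ 0 := inv_ne_zero (by exact_mod_cast n.factorial_ne_zero)
  exact norm_le_norm_restrict_of_tendsto _ hp (fun k => hχp (v k)) hn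
    (ho.mono fun k hk => inner_twistedTensor_self hχ hk)
    (tendsto_inner_symmOp_twistedTensor hχ A hA hv)

/-! ### Norms of sums of two operators -/

/-- Let `P i` be orthogonal projections commuting with `T₂` such that `T₁` raises the filtration
they define by one step, and let `T₁ - T₁ P N` have norm less than `M ≥ ‖T₁‖, ‖T₂‖`. Then `T₁` and
`T₂` cannot both attain `M` on the same vectors with the same values: along a sequence maximizing
`‖(T₁ + T₂) x‖`, the values of `T₁` and `T₂` agree asymptotically, so that smallness of `P i x`
passes through `T₁`, then `T₂`, to `P (i + 1) x`, and `T₁ x` is asymptotically `(T₁ - T₁ P N) x`. -/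
theorem norm_add_lt_of_filtration {E : Type*} [NormedAddCommGroup E] [InnerProductSpace ℂ E]
    (T₁ T₂ : E →L[ℂ] E) (P : ℕ → E →L[ℂ] E) {M r : ℝ} (N : ℕ)
    (h₁ : ‖T₁‖ ≤ M) (h₂ : ‖T₂‖ ≤ M) (hP0 : P 0 = 0)
    (hP : ∀ i x, ‖x‖ ^ 2 = ‖P i x‖ ^ 2 + ‖x - P i x‖ ^ 2)
    (hT₁ : ∀ i x, P (i + 1) (T₁ x) = T₁ (P i x)) (hT₂ : ∀ i x, P i (T₂ x) = T₂ (P i x))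
    (hN : ∀ x, ‖T₁ x - T₁ (P N x)‖ ≤ r * ‖x‖) (hr0 : 0 ≤ r) (hr : r < M) :
    ‖T₁ + T₂‖ < 2 * M := by
  by_contra! hcon
  have hM : 0 < M := hr0.trans_lt hr
  have hx (k : ℕ) : ∃ x : E, ‖x‖ < 1 ∧ 2 * M - 1 / ((k : ℝ) + 1) < ‖(T₁ + T₂) x‖ := by
    refine ContinuousLinearMap.exists_lt_apply_of_lt_opNorm _ (lt_of_lt_of_le ?_ hcon)
    have : 0 < 1 / ((k : ℝ) + 1) := by positivity
    linarith
  choose x hx1 hx2 using hx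
  have hδ := tendsto_one_div_add_atTop_nhds_zero_nat (𝕜 := ℝ)
  have hle {T : E →L[ℂ] E} (hT : ‖T‖ ≤ M) (y : E) : ‖T y‖ ≤ M * ‖y‖ := T.le_of_opNorm_le hT y
  have hle1 {T : E →L[ℂ] E} (hT : ‖T‖ ≤ M) (k : ℕ) : ‖T (x k)‖ ≤ M := by
    nlinarith [hle hT (x k), hx1 k]
  have hsum (k : ℕ) : ‖(T₁ + T₂) (x k)‖ ≤ ‖T₁ (x k)‖ + ‖T₂ (x k)‖ := norm_add_le _ _
  have hlim : Tendsto (fun k : ℕ => M - 1 / ((k : ℝ) + 1)) atTop (𝓝 M) := by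
    simpa using hδ.const_sub M
  have hl1 : Tendsto (fun k => ‖T₁ (x k)‖) atTop (𝓝 M) :=
    tendsto_of_tendsto_of_tendsto_of_le_of_le hlim tendsto_const_nhds
      (fun k => by have := hle1 h₂ k; have := hsum k; have := hx2 k; linarith) (hle1 h₁)
  have hl2 : Tendsto (fun k => ‖T₂ (x k)‖) atTop (𝓝 M) :=
    tendsto_of_tendsto_of_tendsto_of_le_of_le hlim tendsto_const_nhds
      (fun k => by have := hle1 h₁ k; have := hsum k; have := hx2 k; linarith) (hle1 h₂)
  have hls : Tendsto (fun k => ‖T₁ (x k) + T₂ (x k)‖) atTop (𝓝 (2 * M)) := by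
    refine tendsto_of_tendsto_of_tendsto_of_le_of_le (g := fun k : ℕ => 2 * M - 1 / ((k : ℝ) + 1))
      (by simpa using hδ.const_sub (2 * M)) tendsto_const_nhds (fun k => (hx2 k).le) fun k => ?_
    have := hle1 h₁ k; have := hle1 h₂ k; have := norm_add_le (T₁ (x k)) (T₂ (x k))
    linarith
  have hsub : Tendsto (fun k => T₁ (x k) - T₂ (x k)) atTop (𝓝 0) := by
    have h := ((hl1.pow 2).add (hl2.pow 2)).const_mul 2 |>.sub (hls.pow 2)
    have e : 2 * (M ^ 2 + M ^ 2) - (2 * M) ^ 2 = 0 := by ring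
    rw [e] at h
    have h' : Tendsto (fun k => ‖T₁ (x k) - T₂ (x k)‖ ^ 2) atTop (𝓝 0) := by
      refine h.congr fun k => ?_
      have := parallelogram_law_with_norm ℂ (T₁ (x k)) (T₂ (x k))
      linarith
    rw [tendsto_zero_iff_norm_tendsto_zero]
    simpa using h'.sqrt
  have hPx (i : ℕ) : Tendsto (fun k => P i (x k)) atTop (𝓝 0) := by
    induction i with
    | zero => simp [hP0]
    | succ i ih =>
      have t1 : Tendsto (fun k => T₂ (P (i + 1) (x k))) atTop (𝓝 0) := by
        have a1 := (T₁.continuous.tendsto 0).comp ih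
        have a2 := ((P (i + 1)).continuous.tendsto 0).comp hsub
        rw [map_zero] at a1 a2
        have a3 := a1.sub a2
        rw [sub_zero] at a3
        refine a3.congr fun k => ?_
        simp [hT₁, hT₂]
      -- `T₂` almost attains `M` at `x k`, and it is at most `M` off the range of `P (i + 1)`.
      have t2 : Tendsto (fun k => ‖P (i + 1) (x k)‖ ^ 2) atTop (𝓝 0) := by
        have b : Tendsto (fun k => (M ^ 2)⁻¹ * (M ^ 2 - ‖T₂ (x k)‖ ^ 2 +
            ‖T₂ (P (i + 1) (x k))‖ ^ 2)) atTop (𝓝 0) := by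
          have b0 := ((hl2.pow 2).const_sub (M ^ 2) |>.add (t1.norm.pow 2)).const_mul (M ^ 2)⁻¹
          convert b0 using 2
          rw [norm_zero]
          ring
        refine tendsto_of_tendsto_of_tendsto_of_le_of_le tendsto_const_nhds b
          (fun k => by positivity) fun k => ?_
        have c1 := hP (i + 1) (x k)
        have c2 := hP (i + 1) (T₂ (x k))
        rw [hT₂, ← map_sub] at c2
        have c3 := hle h₂ (x k - P (i + 1) (x k))
        have c4 : ‖T₂ (x k - P (i + 1) (x k))‖ ^ 2 ≤ M ^ 2 * ‖x k - P (i + 1) (x k)‖ ^ 2 := by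
          rw [← mul_pow]; gcongr
        have c5 : ‖x k‖ ^ 2 ≤ 1 := pow_le_one₀ (norm_nonneg _) (hx1 k).le
        rw [le_inv_mul_iff₀ (by positivity)]
        nlinarith [sq_nonneg M]
      rw [tendsto_zero_iff_norm_tendsto_zero]
      simpa using t2.sqrt
  have hfin : M ≤ r := by
    have a1 := (T₁.continuous.tendsto 0).comp (hPx N)
    rw [map_zero] at a1
    refine le_of_tendsto_of_tendsto' hl1 (by simpa using a1.norm.const_add r) fun k => ?_
    have d1 := hN (x k)
    have d2 : ‖T₁ (x k)‖ ≤ ‖T₁ (x k) - T₁ (P N (x k))‖ + ‖T₁ (P N (x k))‖ := by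
      simpa using norm_add_le (T₁ (x k) - T₁ (P N (x k))) (T₁ (P N (x k)))
    have d3 : r * ‖x k‖ ≤ r := mul_le_of_le_one_right hr0 (hx1 k).le
    linarith
  exact hfin.not_gt hr

/-! ### Weighted shifts and initial projections -/

theorem dense_span_basis (e : HilbertBasis ℕ ℂ H) :
    Dense (Submodule.span ℂ (Set.range e) : Set H) :=
  Submodule.dense_iff_topologicalClosure_eq_top.2 e.dense_span

theorem ext_basis (e : HilbertBasis ℕ ℂ H) {A B : H →L[ℂ] H} (h : ∀ i, A (e i) = B (e i)) :
    A = B := by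
  refine ContinuousLinearMap.ext_on (dense_span_basis e) ?_
  rintro _ ⟨i, rfl⟩
  exact h i

theorem IsWeightedShift.norm_le {e : HilbertBasis ℕ ℂ H} {α : ℕ → ℂ} {S : H →L[ℂ] H}
    (hS : IsWeightedShift e α S) {C : ℝ} (hC : ∀ i, ‖α i‖ ≤ C) : ‖S‖ ≤ C := by
  have hC0 : 0 ≤ C := (norm_nonneg _).trans (hC 0)
  refine S.opNorm_le_bound hC0 fun x => ?_
  refine (dense_span_basis e).induction (P := fun x => ‖S x‖ ≤ C * ‖x‖) (fun y hy => ?_)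
    (isClosed_le (by fun_prop) (by fun_prop)) x
  obtain ⟨c, rfl⟩ := Finsupp.mem_span_range_iff_exists_finsupp.1 hy
  refine le_of_sq_le_sq ?_ (by positivity)
  have h1 : S (c.sum fun i a => a • e i) = ∑ i ∈ c.support, (c i * α i) • e (i + 1) := by
    simp only [Finsupp.sum, map_sum, map_smul, hS _, smul_smul]
  rw [mul_pow, h1, Finsupp.sum, norm_sq_finsupp_sum e.orthonormal c c,
    norm_sq_finsupp_sum (v := fun i => e (i + 1))
      (e.orthonormal.comp _ (add_left_injective 1)) c (fun i => c i * α i), Finset.mul_sum]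
  refine Finset.sum_le_sum fun i _ => ?_
  rw [norm_mul, mul_pow, mul_comm]
  gcongr
  exact hC i

theorem IsWeightedShift.norm_weight_le {e : HilbertBasis ℕ ℂ H} {α : ℕ → ℂ} {S : H →L[ℂ] H}
    (hS : IsWeightedShift e α S) (i : ℕ) : ‖α i‖ ≤ ‖S‖ := by
  have h := S.le_opNorm (e i)
  rwa [hS, norm_smul, e.orthonormal.1, e.orthonormal.1, mul_one, mul_one] at h

/-- The orthogonal projection onto the span of `e 0, …, e (N - 1)`. -/
def initialProj (e : HilbertBasis ℕ ℂ H) (N : ℕ) : H →L[ℂ] H :=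
  haveI : FiniteDimensional ℂ (Submodule.span ℂ (e '' Set.Iio N)) :=
    FiniteDimensional.span_of_finite ℂ ((Set.finite_Iio N).image e)
  (Submodule.span ℂ (e '' Set.Iio N)).starProjection

theorem initialProj_apply (e : HilbertBasis ℕ ℂ H) (N j : ℕ) :
    initialProj e N (e j) = if j < N then e j else 0 := by
  have : FiniteDimensional ℂ (Submodule.span ℂ (e '' Set.Iio N)) :=
    FiniteDimensional.span_of_finite ℂ ((Set.finite_Iio N).image e)
  unfold initialProj
  split_ifs with h
  · exact Submodule.starProjection_eq_self_iff.2 (Submodule.subset_span ⟨j, h, rfl⟩)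
  · rw [Submodule.starProjection_apply_eq_zero_iff, Submodule.mem_orthogonal]
    intro u hu
    induction hu using Submodule.span_induction with
    | mem x hx =>
      obtain ⟨i, hi, rfl⟩ := hx
      exact e.orthonormal.2 fun hij => h (hij ▸ hi)
    | zero => simp
    | add x y _ _ hx hy => rw [inner_add_left, hx, hy, add_zero]
    | smul a x _ hx => rw [inner_smul_left, hx, mul_zero]

theorem isStarProjection_initialProj [CompleteSpace H] (e : HilbertBasis ℕ ℂ H) (N : ℕ) :
    IsStarProjection (initialProj e N) := by
  have : FiniteDimensional ℂ (Submodule.span ℂ (e '' Set.Iio N)) :=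
    FiniteDimensional.span_of_finite ℂ ((Set.finite_Iio N).image e)
  exact isStarProjection_starProjection

theorem initialProj_zero (e : HilbertBasis ℕ ℂ H) : initialProj e 0 = 0 :=
  ext_basis e fun i => by simp [initialProj_apply]

theorem IsWeightedShift.initialProj_mul {e : HilbertBasis ℕ ℂ H} {α : ℕ → ℂ} {S : H →L[ℂ] H}
    (hS : IsWeightedShift e α S) (i : ℕ) : initialProj e (i + 1) * S = S * initialProj e i := by
  refine ext_basis e fun j => ?_
  simp only [mul_apply_eq_comp, initialProj_apply, hS j, map_smul]
  split_ifs <;> simp_all [hS j]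

theorem IsWeightedShift.norm_sub_mul_initialProj_le {e : HilbertBasis ℕ ℂ H} {α : ℕ → ℂ}
    {S : H →L[ℂ] H} (hS : IsWeightedShift e α S) {N : ℕ} {r : ℝ} (hr0 : 0 ≤ r)
    (hr : ∀ i, N ≤ i → ‖α i‖ ≤ r) : ‖S - S * initialProj e N‖ ≤ r := by
  have h : IsWeightedShift e (fun i => if i < N then 0 else α i) (S - S * initialProj e N) := by
    intro i
    simp only [sub_apply, mul_apply_eq_comp, initialProj_apply, hS i]
    split_ifs <;> simp [hS i]
  refine h.norm_le fun i => ?_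
  split_ifs with hi
  · simpa using hr0
  · exact hr i (not_lt.1 hi)

/-! ### A strict inequality for weights that are not regular -/

theorem tensorOp_pair_mul (A B C D : H →L[ℂ] H) :
    tensorOp ![A, B] * tensorOp ![C, D] = tensorOp ![A * C, B * D] := by
  rw [tensorOp_mul]
  congr 1
  funext i
  fin_cases i <;> rfl

theorem norm_tensorOp_pair_le (A B : H →L[ℂ] H) : ‖tensorOp ![A, B]‖ ≤ ‖A‖ * ‖B‖ := by
  simpa using norm_tensorOp_le ![A, B]

theorem norm_sq_eq_add_of_isStarProjection {E : Type*} [NormedAddCommGroup E]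
    [InnerProductSpace ℂ E] [CompleteSpace E] {P : E →L[ℂ] E} (hP : IsStarProjection P) (x : E) :
    ‖x‖ ^ 2 = ‖P x‖ ^ 2 + ‖x - P x‖ ^ 2 := by
  have h1 : P (P x) = P x := DFunLike.congr_fun hP.isIdempotentElem.eq x
  have h : ⟪P x, x - P x⟫_ℂ = 0 := by
    rw [← ContinuousLinearMap.adjoint_inner_right, hP.isSelfAdjoint.adjoint_eq, map_sub, h1,
      sub_self, inner_zero_right]
  have h2 := norm_add_sq_eq_norm_sq_add_norm_sq_of_inner_eq_zero _ _ h
  rw [add_sub_cancel] at h2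
  linarith

theorem isStarProjection_tensorOp [CompleteSpace H] {P : Fin n → H →L[ℂ] H}
    (hP : ∀ i, IsStarProjection (P i)) : IsStarProjection (tensorOp P) := by
  refine ⟨?_, ?_⟩
  · rw [IsIdempotentElem, tensorOp_mul]
    exact congrArg tensorOp (funext fun i => (hP i).isIdempotentElem.eq)
  · rw [IsSelfAdjoint, ContinuousLinearMap.star_eq_adjoint, adjoint_tensorOp]
    exact congrArg tensorOp (funext fun i => (hP i).isSelfAdjoint.adjoint_eq)

/-- If some weight exceeds the limit of the weights in modulus, then `½ (S ⊗ 1 + 1 ⊗ S)` has norm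
less than `‖S‖`. -/
theorem IsWeightedShift.norm_symmOp_pair_lt [CompleteSpace H] {e : HilbertBasis ℕ ℂ H} {α : ℕ → ℂ}
    {S : H →L[ℂ] H} (hS : IsWeightedShift e α S) {L : ℝ}
    (hL : Tendsto (fun i => ‖α i‖) atTop (𝓝 L)) {m : ℕ} (hm : L < ‖α m‖) :
    ‖symmOp ![S, 1]‖ < ‖S‖ := by
  have hLS : L < ‖S‖ := hm.trans_le (hS.norm_weight_le m)
  have hL0 : 0 ≤ L := ge_of_tendsto' hL fun i => norm_nonneg _
  obtain ⟨r, hLr, hrS⟩ := exists_between hLS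
  obtain ⟨N, hN⟩ := eventually_atTop.1 (hL.eventually_le_const hLr)
  have hr0 : 0 ≤ r := hL0.trans hLr.le
  have h1 : ‖(1 : H →L[ℂ] H)‖ ≤ 1 := ContinuousLinearMap.norm_id_le
  have key : ‖tensorOp ![S, 1] + tensorOp ![1, S]‖ < 2 * ‖S‖ := by
    refine norm_add_lt_of_filtration _ _ (fun i => tensorOp ![initialProj e i, 1]) N
      (r := r) ?_ ?_ ?_ ?_ ?_ ?_ ?_ hr0 hrS
    · exact (norm_tensorOp_pair_le _ _).trans (mul_le_of_le_one_right (norm_nonneg _) h1)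
    · exact (norm_tensorOp_pair_le _ _).trans (mul_le_of_le_one_left (norm_nonneg _) h1)
    · rw [← norm_le_zero_iff]
      refine (norm_tensorOp_pair_le _ _).trans_eq ?_
      rw [initialProj_zero, norm_zero, zero_mul]
    · intro i x
      refine norm_sq_eq_add_of_isStarProjection (isStarProjection_tensorOp fun j => ?_) x
      fin_cases j
      · exact isStarProjection_initialProj e i
      · exact .one _
    · intro i x
      have h : tensorOp ![initialProj e (i + 1), 1] * tensorOp ![S, 1] =
          tensorOp ![S, 1] * tensorOp ![initialProj e i, 1] := by
        rw [tensorOp_pair_mul, tensorOp_pair_mul, hS.initialProj_mul]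
      exact DFunLike.congr_fun h x
    · intro i x
      have h : tensorOp ![initialProj e i, 1] * tensorOp ![1, S] =
          tensorOp ![1, S] * tensorOp ![initialProj e i, 1] := by
        rw [tensorOp_pair_mul, tensorOp_pair_mul, one_mul, one_mul, mul_one, mul_one]
      exact DFunLike.congr_fun h x
    · intro x
      have h : tensorOp ![S, 1] =
          tensorOp ![S - S * initialProj e N, 1] +
            tensorOp ![S, 1] * tensorOp ![initialProj e N, 1] := by
        have h2 := tensorOp_update_add ![S, 1] 0 (S - S * initialProj e N) (S * initialProj e N)
        have h3 (B : H →L[ℂ] H) : Function.update ![S, (1 : H →L[ℂ] H)] 0 B = ![B, 1] := by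
          funext j
          fin_cases j <;> rfl
        rw [h3, h3, h3, sub_add_cancel] at h2
        rw [tensorOp_pair_mul, mul_one, h2]
      have h4 : tensorOp ![S, 1] x - tensorOp ![S, 1] (tensorOp ![initialProj e N, 1] x) =
          tensorOp ![S - S * initialProj e N, 1] x := by
        rw [sub_eq_iff_eq_add]
        exact DFunLike.congr_fun h x
      rw [h4]
      refine ContinuousLinearMap.le_of_opNorm_le _ ((norm_tensorOp_pair_le _ _).trans ?_) x
      exact (mul_le_of_le_one_right (norm_nonneg _) h1).trans
        (hS.norm_sub_mul_initialProj_le hr0 hN)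
  have hs : symmOp ![S, 1] = (2 : ℂ)⁻¹ • (tensorOp ![S, 1] + tensorOp ![1, S]) := by
    have hu : (Finset.univ : Finset (Equiv.Perm (Fin 2))) = {1, Equiv.swap 0 1} := by decide
    have hne : (1 : Equiv.Perm (Fin 2)) ≠ Equiv.swap 0 1 := by decide
    rw [symmOp, hu, Finset.sum_pair hne]
    congr 4
    funext j
    fin_cases j <;> rfl
  rw [hs, norm_smul, norm_inv, Complex.norm_ofNat]
  linarith

/-! ### Approximate eigenvectors of weighted shifts -/

/-- The unit vector `k^{-1/2} ∑ e j` over the block `k (i + 1) ≤ j < k (i + 2)`. For fixed `k ≠ 0`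
different `i` give disjoint blocks, and the blocks move to infinity with `k`. -/
def blockVector (e : HilbertBasis ℕ ℂ H) (k i : ℕ) : H :=
  ((√(k : ℝ) : ℝ) : ℂ)⁻¹ • ∑ j ∈ Finset.range k, e (k * (i + 1) + j)

theorem orthonormal_blockVector (e : HilbertBasis ℕ ℂ H) {k : ℕ} (hk : k ≠ 0) :
    Orthonormal ℂ (blockVector e k) := by
  rw [orthonormal_iff_ite]
  intro i i'
  have hs : ((√(k : ℝ) : ℝ) : ℂ) * ((√(k : ℝ) : ℝ) : ℂ) = k := by
    rw [← Complex.ofReal_mul, Real.mul_self_sqrt (Nat.cast_nonneg k), Complex.ofReal_natCast]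
  have hk' : (k : ℂ) ≠ 0 := Nat.cast_ne_zero.2 hk
  simp only [blockVector, inner_smul_left, inner_smul_right, sum_inner, inner_sum,
    orthonormal_iff_ite.1 e.orthonormal, map_inv₀, Complex.conj_ofReal]
  rw [← Finset.mul_sum, ← mul_assoc, ← mul_inv, hs]
  split_ifs with hi
  · subst hi
    have : ∀ x ∈ Finset.range k, ∑ y ∈ Finset.range k,
        (if k * (i + 1) + y = k * (i + 1) + x then (1 : ℂ) else 0) = 1 := by
      intro x hx
      simp [Finset.mem_range.1 hx]
    rw [Finset.sum_congr rfl this]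
    simp [hk']
  · rw [Finset.sum_eq_zero, mul_zero]
    intro x hx
    refine Finset.sum_eq_zero fun y hy => if_neg fun h => hi ?_
    have hd := congrArg (· / k) h
    simpa [Nat.mul_add_div (Nat.pos_of_ne_zero hk), Nat.div_eq_of_lt (Finset.mem_range.1 hx),
      Nat.div_eq_of_lt (Finset.mem_range.1 hy), eq_comm] using hd

theorem norm_sum_smul_le_sqrt {v : ℕ → H} (hv : Orthonormal ℂ v) {ε : ℝ} (hε : 0 ≤ ε) {k : ℕ}
    {b : ℕ → ℂ} (hb : ∀ j, ‖b j‖ ≤ ε) : ‖∑ j ∈ Finset.range k, b j • v j‖ ≤ √(k : ℝ) * ε := by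
  refine le_of_sq_le_sq ?_ (by positivity)
  have h := hv.inner_sum b b (Finset.range k)
  rw [inner_self_eq_norm_sq_to_K] at h
  simp only [Complex.conj_mul', Complex.coe_algebraMap] at h
  have h' : ‖∑ j ∈ Finset.range k, b j • v j‖ ^ 2 = ∑ j ∈ Finset.range k, ‖b j‖ ^ 2 := by
    exact_mod_cast h
  rw [h', mul_pow, Real.sq_sqrt (Nat.cast_nonneg k)]
  refine (Finset.sum_le_card_nsmul _ _ (ε ^ 2) fun j _ => ?_).trans_eq (by simp)
  gcongr
  exact hb j

theorem IsWeightedShift.norm_apply_blockVector_sub_le {e : HilbertBasis ℕ ℂ H} {α : ℕ → ℂ}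
    {S : H →L[ℂ] H} (hS : IsWeightedShift e α S) {a : ℂ} {ε : ℝ} (hε : 0 ≤ ε) {k : ℕ} (hk : k ≠ 0)
    (hα : ∀ j, k ≤ j → ‖α j - a‖ ≤ ε) (i : ℕ) :
    ‖S (blockVector e k i) - a • blockVector e k i‖ ≤ ε + (√(k : ℝ))⁻¹ * (2 * ‖a‖) := by
  set s := k * (i + 1) with hs
  have hsk : k ≤ s := Nat.le_mul_of_pos_right k i.succ_pos
  have hk0 : 0 < √(k : ℝ) := Real.sqrt_pos.2 (by exact_mod_cast Nat.pos_of_ne_zero hk)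
  -- Shifting a block changes it by its two end vectors only.
  have h1 : S (∑ j ∈ Finset.range k, e (s + j)) - a • ∑ j ∈ Finset.range k, e (s + j) =
      ∑ j ∈ Finset.range k, (α (s + j) - a) • e (s + j + 1) + a • (e (s + k) - e s) := by
    have h2 := Finset.sum_range_sub (fun j => e (s + j)) k
    simp only [add_zero] at h2
    rw [map_sum, ← h2, Finset.smul_sum, Finset.smul_sum, ← Finset.sum_sub_distrib,
      ← Finset.sum_add_distrib]
    refine Finset.sum_congr rfl fun j _ => ?_
    rw [hS, ← add_assoc, sub_smul, smul_sub]
    abel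
  have h3 : ‖∑ j ∈ Finset.range k, (α (s + j) - a) • e (s + j + 1)‖ ≤ √(k : ℝ) * ε :=
    norm_sum_smul_le_sqrt (v := fun j => e (s + j + 1))
      (e.orthonormal.comp (fun j => s + j + 1) fun x y h => by simpa using h) hε
      fun j => hα _ (hsk.trans (Nat.le_add_right _ _))
  have h4 : ‖a • (e (s + k) - e s)‖ ≤ 2 * ‖a‖ := by
    rw [norm_smul, mul_comm]
    gcongr
    refine (norm_sub_le _ _).trans_eq ?_
    rw [e.orthonormal.1, e.orthonormal.1]
    norm_num
  rw [blockVector, map_smul, smul_comm a, ← smul_sub, norm_smul, norm_inv, Complex.norm_real,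
    Real.norm_of_nonneg hk0.le, ← hs, h1]
  calc (√(k : ℝ))⁻¹ * ‖_‖ ≤ (√(k : ℝ))⁻¹ * (√(k : ℝ) * ε + 2 * ‖a‖) := by
        gcongr
        exact (norm_add_le _ _).trans (add_le_add h3 h4)
    _ = ε + (√(k : ℝ))⁻¹ * (2 * ‖a‖) := by field_simp

theorem IsWeightedShift.tendsto_apply_blockVector_sub {e : HilbertBasis ℕ ℂ H} {α : ℕ → ℂ}
    {S : H →L[ℂ] H} (hS : IsWeightedShift e α S) {a : ℂ} (ha : Tendsto α atTop (𝓝 a)) (i : ℕ) :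
    Tendsto (fun k => S (blockVector e k i) - a • blockVector e k i) atTop (𝓝 0) := by
  have hs : Tendsto (fun k : ℕ => (√(k : ℝ))⁻¹ * (2 * ‖a‖)) atTop (𝓝 0) := by
    simpa using (tendsto_inv_atTop_zero.comp
      (Real.tendsto_sqrt_atTop.comp tendsto_natCast_atTop_atTop)).mul_const (2 * ‖a‖)
  rw [Metric.tendsto_nhds]
  intro ε hε
  obtain ⟨K, hK⟩ := Metric.tendsto_atTop.1 ha (ε / 2) (half_pos hε)
  filter_upwards [eventually_ge_atTop K, eventually_ne_atTop 0,
    hs.eventually_lt_const (half_pos hε)] with k hkK hk0 hk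
  have h := hS.norm_apply_blockVector_sub_le (half_pos hε).le hk0 (a := a) (fun j hj => by
    have := hK j (hkK.trans hj)
    rw [dist_eq_norm] at this
    exact this.le) i
  rw [dist_zero_right]
  linarith

theorem tendsto_pow_apply_sub {ι : Type*} {f : Filter ι} {S : H →L[ℂ] H} {a : ℂ} {v : ι → H}
    (h : Tendsto (fun k => S (v k) - a • v k) f (𝓝 0)) (l : ℕ) :
    Tendsto (fun k => (S ^ l) (v k) - a ^ l • v k) f (𝓝 0) := by
  induction l with
  | zero => simpa using tendsto_const_nhds
  | succ l ih =>
    have h1 := ((S ^ l).continuous.tendsto 0).comp h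
    rw [map_zero] at h1
    have h2 := h1.add (ih.const_smul a)
    rw [smul_zero, add_zero] at h2
    refine h2.congr fun k => ?_
    simp only [Function.comp_apply, map_sub, map_smul, pow_succ, mul_apply_eq_comp, smul_sub,
      smul_smul]
    rw [mul_comm a]
    abel

theorem IsWeightedShift.tendsto_inner_pow_blockVector {e : HilbertBasis ℕ ℂ H} {α : ℕ → ℂ}
    {S : H →L[ℂ] H} (hS : IsWeightedShift e α S) {a : ℂ} (ha : Tendsto α atTop (𝓝 a)) (l i j : ℕ) :
    Tendsto (fun k => ⟪blockVector e k i, (S ^ l) (blockVector e k j)⟫_ℂ) atTop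
      (𝓝 (if i = j then a ^ l else 0)) := by
  have h1 := tendsto_pow_apply_sub (hS.tendsto_apply_blockVector_sub ha j) l
  have h2 : Tendsto (fun k => ⟪blockVector e k i, (S ^ l) (blockVector e k j) -
      a ^ l • blockVector e k j⟫_ℂ) atTop (𝓝 0) := by
    refine squeeze_zero_norm' ?_ (tendsto_zero_iff_norm_tendsto_zero.1 h1)
    filter_upwards [eventually_ne_atTop 0] with k hk
    refine (norm_inner_le_norm _ _).trans_eq ?_
    rw [(orthonormal_blockVector e hk).1, one_mul]
  have h3 := h2.add_const (if i = j then a ^ l else 0)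
  rw [zero_add] at h3
  refine h3.congr' ?_
  filter_upwards [eventually_ne_atTop 0] with k hk
  rw [inner_sub_right, inner_smul_right, orthonormal_iff_ite.1 (orthonormal_blockVector e hk)]
  split_ifs <;> simp

theorem IsWeightedShift.tendsto_inner_shiftFactors [CompleteSpace H] {e : HilbertBasis ℕ ℂ H}
    {α : ℕ → ℂ} {S : H →L[ℂ] H} (hS : IsWeightedShift e α S) {a : ℂ} (ha : Tendsto α atTop (𝓝 a))
    (k : ℕ) (l : Fin n → ℕ) (m : Fin n) (i j : ℕ) :
    Tendsto (fun N => ⟪blockVector e N i, shiftFactors S k l m (blockVector e N j)⟫_ℂ) atTop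
      (𝓝 (if i = j then (if (m : ℕ) < k then a ^ l m else starRingEnd ℂ (a ^ l m)) else 0)) := by
  unfold shiftFactors
  by_cases hm : (m : ℕ) < k
  · simpa only [if_pos hm] using hS.tendsto_inner_pow_blockVector ha (l m) i j
  · simp only [if_neg hm]
    have h := (Complex.continuous_conj.tendsto _).comp
      (hS.tendsto_inner_pow_blockVector ha (l m) j i)
    have e1 : (if i = j then starRingEnd ℂ (a ^ l m) else 0) =
        starRingEnd ℂ (if j = i then a ^ l m else 0) := by
      by_cases hij : i = j <;> simp [hij, eq_comm]
    rw [e1]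
    refine h.congr fun N => ?_
    rw [Function.comp_apply, inner_conj_symm, ← ContinuousLinearMap.adjoint_inner_right,
      ← ContinuousLinearMap.star_eq_adjoint, ← ContinuousLinearMap.star_eq_adjoint, star_pow]

/-! ### Norms of symmetric and antisymmetric products -/

theorem norm_shiftFactors [CompleteSpace H] (S : H →L[ℂ] H) (k : ℕ) (l : Fin n → ℕ) (i : Fin n) :
    ‖shiftFactors S k l i‖ = ‖S ^ l i‖ := by
  unfold shiftFactors
  split_ifs
  · rfl
  · rw [← ContinuousLinearMap.star_eq_adjoint, ← star_pow, norm_star]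

theorem norm_symmProd_le (A : Fin n → H →L[ℂ] H) : ‖symmProd A‖ ≤ ‖symmOp A‖ :=
  norm_restrict_le _ _

theorem norm_wedgeProd_le (A : Fin n → H →L[ℂ] H) : ‖wedgeProd A‖ ≤ ‖symmOp A‖ :=
  norm_restrict_le _ _

theorem norm_symmOp_shiftFactors_le [CompleteSpace H] (S : H →L[ℂ] H) (k : ℕ) (l : Fin n → ℕ) :
    ‖symmOp (shiftFactors S k l)‖ ≤ ∏ i, ‖S ^ l i‖ :=
  (norm_symmOp_le _).trans_eq (Finset.prod_congr rfl fun i _ => norm_shiftFactors S k l i)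

theorem prod_norm_eigenvalue (a : ℂ) (k : ℕ) (l : Fin n → ℕ) :
    ∏ m : Fin n, ‖if (m : ℕ) < k then a ^ l m else starRingEnd ℂ (a ^ l m)‖ =
      ‖a‖ ^ ∑ i, l i := by
  rw [← Finset.prod_pow_eq_pow_sum]
  refine Finset.prod_congr rfl fun m _ => ?_
  split_ifs <;> simp

theorem IsWeightedShift.norm_pow_le_norm_symmProd [CompleteSpace H] {e : HilbertBasis ℕ ℂ H}
    {α : ℕ → ℂ} {S : H →L[ℂ] H} (hS : IsWeightedShift e α S) {a : ℂ} (ha : Tendsto α atTop (𝓝 a))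
    (k : ℕ) (l : Fin n → ℕ) : ‖a‖ ^ ∑ i, l i ≤ ‖symmProd (shiftFactors S k l)‖ := by
  rw [← prod_norm_eigenvalue a k l]
  refine prod_norm_le_norm_restrict_symmOp (χ := 1) (by simp) (shiftFactors S k l) (fun v => ?_)
    (symmOp_mem_symmPower _) (fun v => ?_) (v := fun N i => blockVector e N i) ?_ fun i j m => ?_
  · simp only [← symmTensor_eq_twistedTensor, symmOp_symmTensor]
  · rw [← symmTensor_eq_twistedTensor]
    exact Submodule.le_topologicalClosure _ (Submodule.subset_span ⟨v, rfl⟩)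
  · filter_upwards [eventually_ne_atTop 0] with N hN
    exact (orthonormal_blockVector e hN).comp _ Fin.val_injective
  · simpa only [Fin.val_inj] using hS.tendsto_inner_shiftFactors ha k l m i j

theorem IsWeightedShift.norm_pow_le_norm_wedgeProd [CompleteSpace H] {e : HilbertBasis ℕ ℂ H}
    {α : ℕ → ℂ} {S : H →L[ℂ] H} (hS : IsWeightedShift e α S) {a : ℂ} (ha : Tendsto α atTop (𝓝 a))
    (k : ℕ) (l : Fin n → ℕ) : ‖a‖ ^ ∑ i, l i ≤ ‖wedgeProd (shiftFactors S k l)‖ := by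
  rw [← prod_norm_eigenvalue a k l]
  refine prod_norm_le_norm_restrict_symmOp (χ := fun π => ((Equiv.Perm.sign π : ℤ) : ℂ))
    (fun π => ?_) (shiftFactors S k l) (fun v => ?_)
    (symmOp_mem_wedgePower _) (fun v => ?_) (v := fun N i => blockVector e N i) ?_ fun i j m => ?_
  · rcases Int.units_eq_one_or (Equiv.Perm.sign π) with h | h <;> simp [h]
  · simp only [← wedgeTensor_eq_twistedTensor, symmOp_wedgeTensor]
  · exact Submodule.le_topologicalClosure _ (Submodule.subset_span ⟨v, rfl⟩)
  · filter_upwards [eventually_ne_atTop 0] with N hN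
    exact (orthonormal_blockVector e hN).comp _ Fin.val_injective
  · simpa only [Fin.val_inj] using hS.tendsto_inner_shiftFactors ha k l m i j

theorem IsWeightedShift.prod_norm_pow_le {e : HilbertBasis ℕ ℂ H} {α : ℕ → ℂ} {S : H →L[ℂ] H}
    (hS : IsWeightedShift e α S) {L : ℝ} (hL : ∀ m, ‖α m‖ ≤ L) (l : Fin n → ℕ) :
    ∏ i, ‖S ^ l i‖ ≤ L ^ ∑ i, l i := by
  rw [← Finset.prod_pow_eq_pow_sum]
  refine Finset.prod_le_prod (fun i _ => norm_nonneg _) fun i _ => ?_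
  have hp : ‖S ^ l i‖ ≤ ‖S‖ ^ l i := by
    rcases (l i).eq_zero_or_pos with h | h
    · rw [h, pow_zero, pow_zero]
      exact ContinuousLinearMap.norm_id_le
    · exact norm_pow_le' S h
  refine hp.trans ?_
  gcongr
  exact hS.norm_le hL

/-- Regularity follows from a norm equality for `n = 2` and `(l₁, l₂) = (1, 0)`, on any invariant
subspace. -/
theorem IsWeightedShift.isRegularWeight_of_le [CompleteSpace H] {e : HilbertBasis ℕ ℂ H} {α : ℕ → ℂ}
    {S : H →L[ℂ] H} (hS : IsWeightedShift e α S) (hα : ∃ a : ℂ, Tendsto α atTop (𝓝 a))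
    (h : ∏ i : Fin 2, ‖S ^ (![1, 0] : Fin 2 → ℕ) i‖ ≤ ‖symmOp (shiftFactors S 2 ![1, 0])‖) :
    IsRegularWeight α := by
  obtain ⟨a, ha⟩ := hα
  refine ⟨‖a‖, ha.norm, fun m => ?_⟩
  by_contra! hm
  have hlt := hS.norm_symmOp_pair_lt ha.norm hm
  have hf : shiftFactors S 2 ![1, 0] = ![S, 1] := by
    funext i
    fin_cases i <;> simp [shiftFactors]
  have : Nontrivial H := ⟨e 0, 0, e.orthonormal.ne_zero 0⟩
  rw [hf] at h
  simp at h
  exact h.not_gt hlt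

end TensorShift

end

open TensorShift in
theorem theorem1p1 {H : Type*} [NormedAddCommGroup H] [InnerProductSpace ℂ H] [CompleteSpace H]
    (e : HilbertBasis ℕ ℂ H) (α : ℕ → ℂ) (hα : ∃ a : ℂ, Tendsto α atTop (𝓝 a))
    (S : H →L[ℂ] H) (hS : IsWeightedShift e α S) :
    List.TFAE [
      IsRegularWeight α,
      ∀ n : ℕ, 2 ≤ n → ∀ k ≤ n, ∀ l : Fin n → ℕ,
        ‖symmProd (shiftFactors S k l)‖ = ∏ i, ‖S ^ l i‖,
      ∀ n : ℕ, 2 ≤ n → ∀ k ≤ n, ∀ l : Fin n → ℕ,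
        ‖wedgeProd (shiftFactors S k l)‖ = ∏ i, ‖S ^ l i‖] ∧
    (IsRegularWeight α → ∀ L : ℝ, Tendsto (fun i => ‖α i‖) atTop (𝓝 L) →
      ∀ n : ℕ, 2 ≤ n → ∀ k ≤ n, ∀ l : Fin n → ℕ,
        ‖symmProd (shiftFactors S k l)‖ = L ^ ∑ i, l i ∧
        ‖wedgeProd (shiftFactors S k l)‖ = L ^ ∑ i, l i) := by
  obtain ⟨a, ha⟩ := hα
  have hreg (h : IsRegularWeight α) (m : ℕ) : ‖α m‖ ≤ ‖a‖ := by
    obtain ⟨L, hL, hm⟩ := h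
    exact (hm m).trans_eq (tendsto_nhds_unique hL ha.norm)
  -- The chain `|a| ^ ∑ lᵢ ≤ ‖symmProd‖, ‖wedgeProd‖ ≤ ∏ ‖S ^ lᵢ‖ ≤ |a| ^ ∑ lᵢ`, whose last step
  -- alone uses regularity.
  have hle (h : IsRegularWeight α) {n : ℕ} (l : Fin n → ℕ) :
      ∏ i, ‖S ^ l i‖ ≤ ‖a‖ ^ ∑ i, l i := hS.prod_norm_pow_le (hreg h) l
  have hs {n : ℕ} (k : ℕ) (l : Fin n → ℕ) :
      ‖symmProd (shiftFactors S k l)‖ ≤ ∏ i, ‖S ^ l i‖ :=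
    (norm_symmProd_le _).trans (norm_symmOp_shiftFactors_le S k l)
  have hw {n : ℕ} (k : ℕ) (l : Fin n → ℕ) :
      ‖wedgeProd (shiftFactors S k l)‖ ≤ ∏ i, ‖S ^ l i‖ :=
    (norm_wedgeProd_le _).trans (norm_symmOp_shiftFactors_le S k l)
  refine ⟨?_, fun h L hL n _ k _ l => ?_⟩
  · tfae_have 1 → 2 := fun h n _ k _ l =>
      (hs k l).antisymm ((hle h l).trans (hS.norm_pow_le_norm_symmProd ha k l))
    tfae_have 1 → 3 := fun h n _ k _ l =>
      (hw k l).antisymm ((hle h l).trans (hS.norm_pow_le_norm_wedgeProd ha k l))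
    tfae_have 2 → 1 := fun h => hS.isRegularWeight_of_le ⟨a, ha⟩
      ((h 2 le_rfl 2 le_rfl ![1, 0]).ge.trans (norm_symmProd_le _))
    tfae_have 3 → 1 := fun h => hS.isRegularWeight_of_le ⟨a, ha⟩
      ((h 2 le_rfl 2 le_rfl ![1, 0]).ge.trans (norm_wedgeProd_le _))
    tfae_finish
  · obtain rfl : L = ‖a‖ := tendsto_nhds_unique hL ha.norm
    exact ⟨((hs k l).trans (hle h l)).antisymm (hS.norm_pow_le_norm_symmProd ha k l),
      ((hw k l).trans (hle h l)).antisymm (hS.norm_pow_le_norm_wedgeProd ha k l)⟩
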